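/- A finite hypergraph consists of a finite vertex set $V$ and a set of subsets of $V$, called edges. Its chromatic number is the minimum number of colors needed to color $V$ so that no edge is monochromatic. An $(r,l)$-system is a finite hypergraph all of whose edges have exactly $r$ vertices and in which every two distinct edges share fewer than $l$ vertices. Let $m_k(r,l)$ denote the minimum number of edges in an $(r,l)$-system with chromatic number greater than $k$. Theorem. Fix integers $2\le l<r$. Then for all sufficiently large integers $k$ (depending on $r$ and $l$) an $(r,l)$-system with chromatic number greater than $k$ exists, and $$m_k(r,l)<c_{r,l}\,\bigl(k^{r-1}\log k\bigr)^{l/(l-1)},\qquad c_{r,l}=2\left(\frac{100\,(r)_l^2}{l!}\right)^{1/(l-1)}\left(\frac{10(r-1)}{l-1}\right)^{l/(l-1)},$$ where $(r)_l=r(r-1)\cdots(r-l+1)$ and $\log$ is the natural logarithm. -/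

import Mathlib

open Filter

namespace Hypergraph

variable {α : Type*}

/-- Every edge has exactly `r` vertices. -/
def IsUniform (H : Hypergraph α) (r : ℕ) : Prop :=
  ∀ e ∈ H.edgeSet, e.encard = r

/-- An `(r,l)`-system: an `r`-uniform hypergraph in which every two distinct edges share
fewer than `l` vertices. -/
def IsSystem (H : Hypergraph α) (r l : ℕ) : Prop :=
  H.IsUniform r ∧
    ∀ e ∈ H.edgeSet, ∀ f ∈ H.edgeSet, e ≠ f → (e ∩ f).encard < l

/-- The vertex set can be coloured with `n` colours (the numbers `0, …, n - 1`) so that no edge is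
monochromatic. Values of the colouring outside the vertex set play no role. -/
def Colorable (H : Hypergraph α) (n : ℕ) : Prop :=
  ∃ c : α → ℕ, (∀ x ∈ H.vertexSet, c x < n) ∧
    ∀ e ∈ H.edgeSet, ∃ x ∈ e, ∃ y ∈ e, c x ≠ c y

/-- The least number of colours in a colouring without monochromatic edges
(`⊤` if there is no such colouring with finitely many colours). -/
noncomputable def chromaticNumber (H : Hypergraph α) : ℕ∞ :=
  ⨅ n ∈ {n : ℕ | H.Colorable n}, (n : ℕ∞)

end Hypergraph

/-- The set of all numbers of edges of finite `(r,l)`-systems with chromatic number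
greater than `k`; its least element is `m_k(r,l)`. -/
def systemSizes (r l k : ℕ) : Set ℕ :=
  {m | ∃ (α : Type) (H : Hypergraph α), H.vertexSet.Finite ∧ H.IsSystem r l ∧
    (k : ℕ∞) < H.chromaticNumber ∧ H.edgeSet.encard = m}

/-- The constant `c_{r,l}`; here `r.descFactorial l = r (r - 1) ⋯ (r - l + 1)`. -/
noncomputable def systemConst (r l : ℕ) : ℝ :=
  2 * (100 * (r.descFactorial l : ℝ) ^ 2 / (l.factorial : ℝ)) ^ (1 / ((l : ℝ) - 1)) *
    (10 * ((r : ℝ) - 1) / ((l : ℝ) - 1)) ^ ((l : ℝ) / ((l : ℝ) - 1))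

/-! Take n = k s vertices. If every s-set contains an edge, then any k-colouring has a class with at
least s vertices and so a monochromatic edge. It suffices to find an (r,l)-system with few edges
that meets this condition.

Such a system is built greedily: in each of T rounds an r-set is offered, and it is kept if it meets
all kept edges in fewer than l points. Under random offers an s-set S rarely stays without an edge
unless many kept edges meet S in at least l points and block its r-subsets. Once n^(l-1) is a large
multiple of k^(r-1) log k, such crowding is rare too. `exists_system_of_potential` replaces
probability by averaging a potential. `exists_system_meeting_all` chooses the parameters and gives
at most 4 n k^(r-1) log k edges; taking n nearly minimal produces the exponent l/(l-1). -/

namespace Finset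

variable {α : Type*} [DecidableEq α]

/-! ### Counting r-sets with a prescribed intersection. -/

theorem card_filter_superset_le {S A : Finset α} (r : ℕ) :
    #{e ∈ S.powersetCard r | A ⊆ e} ≤ (#S - #A).choose (r - #A) := by
  by_cases hA : A ⊆ S
  · rw [← card_sdiff_of_subset hA, ← card_powersetCard]
    refine card_le_card_of_injOn (fun e => e \ A) ?_ ?_
    · intro e he
      simp only [coe_filter, mem_powersetCard, Set.mem_ofPred_eq] at he
      obtain ⟨⟨heS, hr⟩, hAe⟩ := he
      simp only [mem_coe, mem_powersetCard]
      exact ⟨sdiff_subset_sdiff heS subset_rfl, by rw [card_sdiff_of_subset hAe, hr]⟩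
    · intro e he e' he' h
      simp only [coe_filter, mem_powersetCard, Set.mem_ofPred_eq] at he he'
      rw [← sdiff_union_of_subset he.2, ← sdiff_union_of_subset he'.2]
      simp only at h
      rw [h]
  · rw [filter_eq_empty_iff.2]
    · simp
    · intro e he hAe
      exact hA (hAe.trans (mem_powersetCard.1 he).1)

/-- Union bound over the l-subsets of `f`. -/
theorem card_filter_le_card_inter_le (S f : Finset α) (r l : ℕ) :
    #{e ∈ S.powersetCard r | l ≤ #(e ∩ f)} ≤
      (#f).choose l * (#S - l).choose (r - l) := by
  have hsub : {e ∈ S.powersetCard r | l ≤ #(e ∩ f)} ⊆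
      (f.powersetCard l).biUnion fun A => {e ∈ S.powersetCard r | A ⊆ e} := by
    intro e he
    obtain ⟨he, hle⟩ := mem_filter.1 he
    obtain ⟨A, hA, hAc⟩ := exists_subset_card_eq hle
    simp only [mem_biUnion, mem_filter]
    exact ⟨A, mem_powersetCard.2 ⟨hA.trans inter_subset_right, hAc⟩, he,
      hA.trans inter_subset_left⟩
  refine (card_le_card hsub).trans (card_biUnion_le.trans ?_)
  rw [← card_powersetCard, ← smul_eq_mul]
  refine sum_le_card_nsmul _ _ _ fun A hA => ?_
  have := card_filter_superset_le (S := S) (A := A) r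
  rwa [(mem_powersetCard.1 hA).2] at this

/-! ### The greedy step and the potential argument. -/

/-- Adds `e` to the family `F` if it meets every member in fewer than `l` points. -/
def insertCompatible (l : ℕ) (F : Finset (Finset α)) (e : Finset α) : Finset (Finset α) :=
  if ∀ f ∈ F, #(e ∩ f) < l then insert e F else F

/-- `S` contains no member of `F` and fewer than `θ` members of `F` meet it in at least `l`
points. -/
def IsFree (l θ : ℕ) (F : Finset (Finset α)) (S : Finset α) : Prop :=
  (∀ f ∈ F, ¬ f ⊆ S) ∧ #{f ∈ F | l ≤ #(f ∩ S)} < θ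

instance (l θ : ℕ) (F : Finset (Finset α)) (S : Finset α) : Decidable (IsFree l θ F S) :=
  inferInstanceAs (Decidable (_ ∧ _))

theorem subset_insertCompatible (l : ℕ) (F : Finset (Finset α)) (e : Finset α) :
    F ⊆ insertCompatible l F e := by
  unfold insertCompatible
  split_ifs
  · exact subset_insert _ _
  · exact subset_rfl

theorem insertCompatible_subset (l : ℕ) (F : Finset (Finset α)) (e : Finset α) :
    insertCompatible l F e ⊆ insert e F := by
  unfold insertCompatible
  split_ifs
  · exact subset_rfl
  · exact subset_insert _ _

theorem card_insertCompatible_le (l : ℕ) (F : Finset (Finset α)) (e : Finset α) :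
    #(insertCompatible l F e) ≤ #F + 1 :=
  (card_le_card (insertCompatible_subset l F e)).trans (card_insert_le _ _)

theorem insertCompatible_pairwise {l : ℕ} {F : Finset (Finset α)} (e : Finset α)
    (hF : ∀ f ∈ F, ∀ g ∈ F, f ≠ g → #(f ∩ g) < l) :
    ∀ f ∈ insertCompatible l F e, ∀ g ∈ insertCompatible l F e, f ≠ g → #(f ∩ g) < l := by
  unfold insertCompatible
  split_ifs with h
  · intro f hf g hg hfg
    rcases mem_insert.1 hf with hfe | hf <;> rcases mem_insert.1 hg with hge | hg
    · exact absurd (hfe.trans hge.symm) hfg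
    · rw [hfe]; exact h g hg
    · rw [inter_comm, hge]; exact h f hf
    · exact hF f hf g hg hfg
  · exact hF

theorem IsFree.mono {l θ : ℕ} {F G : Finset (Finset α)} {S : Finset α} (hFG : F ⊆ G)
    (h : IsFree l θ G S) : IsFree l θ F S :=
  ⟨fun f hf => h.1 f (hFG hf), (card_le_card (filter_subset_filter _ hFG)).trans_lt h.2⟩

/-- An r-set `e ⊆ S` is rejected only if it shares l points with some `f ∈ F`, and then `f` meets
`S` in at least l points. Freeness leaves fewer than θ such `f`; every other r-subset of `S` is
inserted and ends the freeness of `S`. -/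
theorem card_isFree_insertCompatible_add_le {r l θ : ℕ} {V S : Finset α}
    {F : Finset (Finset α)} (hSV : S ⊆ V) (hF : ∀ f ∈ F, #f = r) (h : IsFree l θ F S) :
    #{e ∈ V.powersetCard r | IsFree l θ (insertCompatible l F e) S} + (#S).choose r ≤
      (#V).choose r + θ * (r.choose l * (#S - l).choose (r - l)) := by
  set K := {f ∈ F | l ≤ #(f ∩ S)}.biUnion fun f => {e ∈ S.powersetCard r | l ≤ #(e ∩ f)}
  have hK : #K ≤ θ * (r.choose l * (#S - l).choose (r - l)) := by
    refine card_biUnion_le.trans ?_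
    refine (sum_le_card_nsmul _ _ (r.choose l * (#S - l).choose (r - l)) fun f hf => ?_).trans ?_
    · have := card_filter_le_card_inter_le S f r l
      rwa [hF f (mem_filter.1 hf).1] at this
    · rw [smul_eq_mul]
      exact Nat.mul_le_mul_right _ h.2.le
  have hdisj : Disjoint {e ∈ V.powersetCard r | IsFree l θ (insertCompatible l F e) S}
      (S.powersetCard r \ K) := by
    rw [disjoint_left]
    intro e he heK
    obtain ⟨heS, heK⟩ := mem_sdiff.1 heK
    have hcomp : ∀ f ∈ F, #(e ∩ f) < l := by
      intro f hf
      by_contra! hle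
      refine heK (mem_biUnion.2 ⟨f, mem_filter.2 ⟨hf, hle.trans (card_le_card ?_)⟩,
        mem_filter.2 ⟨heS, hle⟩⟩)
      rw [inter_comm]
      exact inter_subset_inter_left (mem_powersetCard.1 heS).1
    have hfree := (mem_filter.1 he).2
    rw [insertCompatible, if_pos hcomp] at hfree
    exact hfree.1 e (mem_insert_self _ _) (mem_powersetCard.1 heS).1
  have hunion : #({e ∈ V.powersetCard r | IsFree l θ (insertCompatible l F e) S} ∪
      (S.powersetCard r \ K)) ≤ (#V).choose r := by
    rw [← card_powersetCard]
    refine card_le_card (union_subset (filter_subset _ _) (sdiff_subset.trans ?_))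
    exact powersetCard_mono hSV
  rw [card_union_of_disjoint hdisj] at hunion
  have := card_le_card_sdiff_add_card (s := S.powersetCard r) (t := K)
  rw [card_powersetCard] at this
  omega

/-- Exponential moment for crowding: one offer at most doubles the weight of `S`, and only if `e`
meets `S` in at least l points. Rejections only help. -/
theorem sum_two_pow_insertCompatible_le {r l : ℕ} (V S : Finset α) (F : Finset (Finset α)) :
    ∑ e ∈ V.powersetCard r, 2 ^ #{f ∈ insertCompatible l F e | l ≤ #(f ∩ S)} ≤
      2 ^ #{f ∈ F | l ≤ #(f ∩ S)} *
        ((#V).choose r + (#S).choose l * (#V - l).choose (r - l)) := by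
  have hstep : ∀ e ∈ V.powersetCard r,
      2 ^ #{f ∈ insertCompatible l F e | l ≤ #(f ∩ S)} ≤
        2 ^ #{f ∈ F | l ≤ #(f ∩ S)} * (1 + if l ≤ #(e ∩ S) then 1 else 0) := by
    intro e _
    have hle := card_le_card
      (filter_subset_filter (fun f => l ≤ #(f ∩ S)) (insertCompatible_subset l F e))
    rw [filter_insert] at hle
    split_ifs with h
    · rw [if_pos h] at hle
      rw [one_add_one_eq_two, ← pow_succ]
      exact Nat.pow_le_pow_right two_pos (hle.trans (card_insert_le _ _))
    · rw [if_neg h] at hle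
      simpa using Nat.pow_le_pow_right two_pos hle
  refine (sum_le_sum hstep).trans ?_
  rw [← mul_sum, sum_add_distrib, sum_const, smul_eq_mul, mul_one, card_powersetCard,
    ← card_filter]
  gcongr
  exact card_filter_le_card_inter_le V S r l

/-- The semi-random greedy construction of a partial Steiner system that meets every set of
size `s`. -/
theorem exists_system_of_potential {r l s θ T : ℕ} (V : Finset α) (hrV : r ≤ #V) {q ρ : ℝ}
    (hq1 : q < 1) (hρ : 0 ≤ ρ)
    (hq : q * (#V).choose r + θ * (r.choose l * (s - l).choose (r - l)) ≤ s.choose r)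
    (hρV : (s.choose l * (#V - l).choose (r - l) : ℝ) ≤ ρ * (#V).choose r)
    (hU : 2 * (#V).choose s * (1 - q) ^ T < 1)
    (hW : 2 * (#V).choose s * (1 + ρ) ^ T < 2 ^ θ) :
    ∃ F : Finset (Finset α), #F ≤ T ∧ (∀ f ∈ F, #f = r) ∧
      (∀ f ∈ F, ∀ g ∈ F, f ≠ g → #(f ∩ g) < l) ∧
      ∀ S ⊆ V, #S = s → ∃ f ∈ F, f ⊆ S := by
  set U : Finset (Finset α) → ℝ := fun F => #{S ∈ V.powersetCard s | IsFree l θ F S} with hUdef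
  set W : Finset (Finset α) → ℝ :=
    fun F => ∑ S ∈ V.powersetCard s, 2 ^ #{f ∈ F | l ≤ #(f ∩ S)} with hWdef
  have hqp : 0 < 1 - q := by linarith
  have hρp : 0 < 1 + ρ := by linarith
  have hN : 0 < ((#V).choose r : ℝ) := by exact_mod_cast Nat.choose_pos hrV
  have hUstep : ∀ F : Finset (Finset α), (∀ f ∈ F, #f = r) →
      ∑ e ∈ V.powersetCard r, U (insertCompatible l F e) ≤
        (#V).choose r * ((1 - q) * U F) := by
    intro F hF
    simp only [hUdef, card_filter, Nat.cast_sum, mul_sum]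
    rw [sum_comm]
    refine sum_le_sum fun S hS => ?_
    obtain ⟨hSV, hSs⟩ := mem_powersetCard.1 hS
    rw [← Nat.cast_sum, ← card_filter]
    by_cases h : IsFree l θ F S
    · have := card_isFree_insertCompatible_add_le hSV hF h
      rw [hSs] at this
      have h' : (#{e ∈ V.powersetCard r | IsFree l θ (insertCompatible l F e) S} +
          s.choose r : ℝ) ≤ (#V).choose r + θ * (r.choose l * (s - l).choose (r - l)) := by
        exact_mod_cast this
      simp only [h, if_true, Nat.cast_one]
      linarith
    · rw [filter_eq_empty_iff.2]
      · simp [h]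
      · exact fun e _ h' => h (h'.mono (subset_insertCompatible l F e))
  have hWstep : ∀ F : Finset (Finset α),
      ∑ e ∈ V.powersetCard r, W (insertCompatible l F e) ≤
        (#V).choose r * ((1 + ρ) * W F) := by
    intro F
    simp only [hWdef, mul_sum]
    rw [sum_comm]
    refine sum_le_sum fun S hS => ?_
    obtain ⟨hSV, hSs⟩ := mem_powersetCard.1 hS
    have := sum_two_pow_insertCompatible_le (r := r) (l := l) V S F
    rw [hSs] at this
    have h' : (∑ e ∈ V.powersetCard r, 2 ^ #{f ∈ insertCompatible l F e | l ≤ #(f ∩ S)} : ℝ) ≤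
      2 ^ #{f ∈ F | l ≤ #(f ∩ S)} *
        ((#V).choose r + s.choose l * (#V - l).choose (r - l)) := by
      exact_mod_cast this
    refine h'.trans ?_
    have hp : (0 : ℝ) ≤ 2 ^ #{f ∈ F | l ≤ #(f ∩ S)} := by positivity
    calc _ ≤ (2 : ℝ) ^ #{f ∈ F | l ≤ #(f ∩ S)} * ((#V).choose r + ρ * (#V).choose r) := by
          gcongr
      _ = _ := by ring
  -- Each term is normalised by its one-round growth factor, so the average over `e` does not exceed
  -- the current potential and some `e` does not raise it. Initially both terms are at most the
  -- number of s-sets.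
  have key : ∀ t : ℕ, ∃ F : Finset (Finset α), #F ≤ t ∧ (∀ f ∈ F, #f = r) ∧
      (∀ f ∈ F, ∀ g ∈ F, f ≠ g → #(f ∩ g) < l) ∧
      U F / (1 - q) ^ t + W F / (1 + ρ) ^ t ≤ 2 * (#V).choose s := by
    intro t
    induction t with
    | zero =>
      refine ⟨∅, by simp, by simp, by simp, ?_⟩
      have h1 : U ∅ ≤ (#V).choose s := by
        simp only [hUdef]
        exact_mod_cast (card_filter_le _ _).trans_eq (card_powersetCard _ _)
      have h2 : W ∅ = (#V).choose s := by simp [hWdef]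
      rw [h2]
      simp only [pow_zero, div_one]
      linarith
    | succ t ih =>
      obtain ⟨F, hFt, hFr, hFl, hpot⟩ := ih
      have hne : (V.powersetCard r).Nonempty := powersetCard_nonempty.2 hrV
      have hsum : ∑ e ∈ V.powersetCard r, (U (insertCompatible l F e) / (1 - q) ^ (t + 1) +
          W (insertCompatible l F e) / (1 + ρ) ^ (t + 1)) ≤
          ∑ _e ∈ V.powersetCard r, (U F / (1 - q) ^ t + W F / (1 + ρ) ^ t) := by
        rw [sum_add_distrib, ← sum_div, ← sum_div, sum_const, card_powersetCard, nsmul_eq_mul,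
          mul_add]
        refine add_le_add ?_ ?_
        · rw [div_le_iff₀ (by positivity)]
          refine (hUstep F hFr).trans_eq ?_
          field_simp
          ring
        · rw [div_le_iff₀ (by positivity)]
          refine (hWstep F).trans_eq ?_
          field_simp
          ring
      obtain ⟨e, he, hle⟩ := exists_le_of_sum_le hne hsum
      refine ⟨insertCompatible l F e, (card_insertCompatible_le l F e).trans (by omega), ?_,
        insertCompatible_pairwise e hFl, hle.trans hpot⟩
      intro f hf
      rcases mem_insert.1 (insertCompatible_subset l F e hf) with rfl | hf
      · exact (mem_powersetCard.1 he).2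
      · exact hFr f hf
  obtain ⟨F, hFT, hFr, hFl, hpot⟩ := key T
  have hU0 : 0 ≤ U F / (1 - q) ^ T := by simp only [hUdef]; positivity
  have hW0 : 0 ≤ W F / (1 + ρ) ^ T := by simp only [hWdef]; positivity
  refine ⟨F, hFT, hFr, hFl, fun S hSV hSs => ?_⟩
  have hS : S ∈ V.powersetCard s := mem_powersetCard.2 ⟨hSV, hSs⟩
  -- `U F < 1` leaves no free s-set, and `W F < 2 ^ θ` leaves none crowded; hence each contains an
  -- edge.
  have hUF : U F < 1 := by
    have : U F / (1 - q) ^ T ≤ 2 * (#V).choose s := by linarith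
    rw [div_le_iff₀ (by positivity)] at this
    linarith
  have hWF : W F < 2 ^ θ := by
    have : W F / (1 + ρ) ^ T ≤ 2 * (#V).choose s := by linarith
    rw [div_le_iff₀ (by positivity)] at this
    linarith
  have hSθ : #{f ∈ F | l ≤ #(f ∩ S)} < θ := by
    have h1 : (2 : ℝ) ^ #{f ∈ F | l ≤ #(f ∩ S)} ≤ W F :=
      single_le_sum (f := fun S => (2 : ℝ) ^ #{f ∈ F | l ≤ #(f ∩ S)})
        (fun _ _ => by positivity) hS
    exact (pow_lt_pow_iff_right₀ one_lt_two).1 (h1.trans_lt hWF)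
  by_contra! hcon
  have : 0 < #{S ∈ V.powersetCard s | IsFree l θ F S} :=
    card_pos.2 ⟨S, mem_filter.2 ⟨hS, hcon, hSθ⟩⟩
  simp only [hUdef, Nat.cast_lt_one] at hUF
  omega

end Finset

/-! ### Estimates for binomial coefficients. -/

namespace Nat

/-- Bernoulli's inequality: (1 - r/m)^r ≥ 1 - r²/m ≥ 4/5. -/
theorem four_mul_pow_le_five_mul_sub_pow {m r : ℕ} (h : 5 * r ^ 2 ≤ m) :
    4 * (m : ℝ) ^ r ≤ 5 * ((m + 1 - r : ℕ) : ℝ) ^ r := by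
  rcases Nat.eq_zero_or_pos r with rfl | hr
  · norm_num
  have hrm : r ≤ m := by nlinarith
  have hm : (0 : ℝ) < m := by exact_mod_cast hr.trans_le hrm
  have hr' : (r : ℝ) ≤ m := by exact_mod_cast hrm
  have h' : (5 * r ^ 2 : ℝ) ≤ m := by exact_mod_cast h
  have hb := one_add_mul_le_pow (a := -(r / m : ℝ)) (by
    have : (r / m : ℝ) ≤ 1 := (div_le_one hm).2 hr'
    linarith) r
  have h45 : (4 / 5 : ℝ) ≤ (1 + -(r / m : ℝ)) ^ r := by
    refine le_trans ?_ hb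
    have : (r : ℝ) * (r / m) ≤ 1 / 5 := by
      rw [mul_div_assoc', div_le_iff₀ hm]
      linarith
    linarith
  have hsub : (m : ℝ) * (1 + -(r / m : ℝ)) ≤ ((m + 1 - r : ℕ) : ℝ) := by
    rw [Nat.cast_sub (by omega)]
    push_cast
    have : (m : ℝ) * (1 + -(r / m : ℝ)) = m - r := by field_simp; ring
    linarith
  have hnn : 0 ≤ (m : ℝ) * (1 + -(r / m : ℝ)) := by
    have : (m : ℝ) * (1 + -(r / m : ℝ)) = m - r := by field_simp; ring
    linarith
  have := pow_le_pow_left₀ hnn hsub r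
  rw [mul_pow] at this
  have h2 := mul_le_mul_of_nonneg_left h45 (pow_nonneg hm.le r)
  linarith

theorem four_mul_pow_le_choose {m r : ℕ} (h : 5 * r ^ 2 ≤ m) :
    4 * (m : ℝ) ^ r ≤ 5 * (r.factorial * m.choose r) := by
  refine (four_mul_pow_le_five_mul_sub_pow h).trans ?_
  have := Nat.pow_le_choose (α := ℝ) r m
  rw [div_le_iff₀ (by positivity)] at this
  linarith

theorem choose_mul_le_exp {k s : ℕ} (hk : 0 < k) :
    ((k * s).choose s : ℝ) ≤ Real.exp (s * Real.log k + s) := by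
  have h1 := Nat.choose_le_pow_div (α := ℝ) s (k * s)
  have h2 := Real.pow_div_factorial_le_exp (s : ℝ) (by positivity) s
  have hk' : (0 : ℝ) < k := by exact_mod_cast hk
  rw [Real.exp_add, mul_comm (s : ℝ), Real.exp_mul, Real.exp_log hk', Real.rpow_natCast]
  refine h1.trans ?_
  push_cast
  rw [mul_pow, mul_div_assoc]
  gcongr

end Nat

/-! ### Choice of parameters. -/

set_option maxHeartbeats 1000000 in
theorem exists_system_meeting_all {r l k s : ℕ} (hl : 2 ≤ l) (hlr : l < r)
    (hk : 11 ≤ Real.log k) (hs : 5 * r ^ 2 ≤ s)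
    (hslog : 10 * (r.choose l : ℝ) ^ 2 * l.factorial * (Real.log k + 3) ≤ s)
    (hn : 40 * l.factorial * (r.choose l : ℝ) ^ 3 * (k ^ (r - 1) * Real.log k) ≤
      ((k * s : ℕ) : ℝ) ^ (l - 1)) :
    ∃ F : Finset (Finset (Fin (k * s))),
      (F.card : ℝ) ≤ 4 * (k * s : ℕ) * (k ^ (r - 1) * Real.log k) ∧ (∀ f ∈ F, f.card = r) ∧
      (∀ f ∈ F, ∀ g ∈ F, f ≠ g → (f ∩ g).card < l) ∧
      ∀ S : Finset (Fin (k * s)), S.card = s → ∃ f ∈ F, f ⊆ S := by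
  have hk0 : 0 < k := by
    rcases Nat.eq_zero_or_pos k with rfl | h
    · norm_num at hk
    · exact h
  have hkR : (1 : ℝ) ≤ k := by exact_mod_cast hk0
  have hrs : r ≤ s := by nlinarith
  have hs1 : 1 ≤ s := by omega
  have hsR : (1 : ℝ) ≤ s := by exact_mod_cast hs1
  set n := k * s with hndef
  have hsn : s ≤ n := Nat.le_mul_of_pos_left s hk0
  have hnR : (n : ℝ) = k * s := by rw [hndef]; push_cast; ring
  set R : ℝ := (r.choose l : ℝ) with hR
  have hR1 : 1 ≤ R := by rw [hR]; exact_mod_cast Nat.choose_pos hlr.le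
  set L : ℝ := k ^ (r - 1) * Real.log k with hL
  have hL1 : 1 ≤ L := by
    have : (1 : ℝ) ≤ k ^ (r - 1) := one_le_pow₀ hkR
    rw [hL]; nlinarith
  have hnL : (k : ℝ) ^ r * s * Real.log k = n * L := by
    obtain ⟨r, rfl⟩ : ∃ r', r = r' + 1 := ⟨r - 1, by omega⟩
    rw [hL, hnR, Nat.add_sub_cancel, pow_succ]; ring
  have hn1 : (1 : ℝ) ≤ n := by rw [hnR]; nlinarith
  have hnr : (0 : ℝ) < n.choose r := by exact_mod_cast Nat.choose_pos (hrs.trans hsn)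
  have hnl : (0 : ℝ) < n.choose l := by
    exact_mod_cast Nat.choose_pos (hlr.le.trans (hrs.trans hsn))
  have hsl : (0 : ℝ) < s.choose l := by exact_mod_cast Nat.choose_pos (hlr.le.trans hrs)
  have hsr : (0 : ℝ) < s.choose r := by exact_mod_cast Nat.choose_pos hrs
  have hlfac : (1 : ℝ) ≤ l.factorial := by exact_mod_cast Nat.factorial_pos l
  have hlr2 : l ^ 2 ≤ r ^ 2 := Nat.pow_le_pow_left hlr.le 2
  have hids : (s.choose r : ℝ) * R = s.choose l * (s - l).choose (r - l) := by
    rw [hR]; exact_mod_cast Nat.choose_mul hlr.le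
  have hidn : (n.choose r : ℝ) * R = n.choose l * (n - l).choose (r - l) := by
    rw [hR]; exact_mod_cast Nat.choose_mul hlr.le
  -- Since q ≥ 2/(5 k^r), the factor 3 gives qT ≥ (6/5) s log k, which beats the bound s log k + s
  -- for the logarithm of the number of s-sets once log k ≥ 11.
  set T : ℕ := ⌈3 * (k ^ r * s * Real.log k)⌉₊ with hT
  have hTge : 3 * (k ^ r * s * Real.log k) ≤ T := Nat.le_ceil _
  have hnL1 : 1 ≤ n * L := by nlinarith
  have hTle : (T : ℝ) ≤ 4 * n * L := by
    have := (Nat.ceil_lt_add_one (a := 3 * (k ^ r * s * Real.log k)) (by positivity)).le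
    rw [← hT, hnL] at this
    linarith
  -- With this θ the blocked r-subsets of an s-set number at most half of all, by `hids`; `q`
  -- accounts for the other half.
  set θ : ℕ := s.choose l / (2 * r.choose l ^ 2) with hθ
  have hθle : (θ : ℝ) * (2 * R ^ 2) ≤ s.choose l := by
    rw [hR, hθ]; exact_mod_cast Nat.div_mul_le_self _ _
  have hθge : (s.choose l : ℝ) / (2 * R ^ 2) - 1 ≤ θ := by
    have := Nat.lt_div_mul_add (a := s.choose l) (b := 2 * r.choose l ^ 2)
      (by have := Nat.choose_pos hlr.le; positivity)
    rw [← hθ] at this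
    have h' : (s.choose l : ℝ) < θ * (2 * R ^ 2) + 2 * R ^ 2 := by
      rw [hR]; exact_mod_cast this
    rw [sub_le_iff_le_add, div_le_iff₀ (by positivity)]
    linarith
  set q : ℝ := s.choose r / (2 * n.choose r) with hq
  set ρ : ℝ := s.choose l * R / n.choose l with hρ
  have hchoose : ((n.choose s : ℕ) : ℝ) ≤ Real.exp (s * Real.log k + s) :=
    Nat.choose_mul_le_exp hk0
  have hexp1 : (2 : ℝ) < Real.exp 1 := by have := Real.exp_one_gt_d9; linarith
  have hq1 : q < 1 := by
    rw [hq, div_lt_one (by positivity)]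
    have : (s.choose r : ℝ) ≤ n.choose r := by exact_mod_cast Nat.choose_le_choose r hsn
    linarith
  have hqge : 2 ≤ q * (5 * (k : ℝ) ^ r) := by
    have h1 := Nat.four_mul_pow_le_choose hs
    have h2 := Nat.choose_le_pow_div (α := ℝ) r n
    rw [le_div_iff₀ (by positivity), hnR, mul_pow] at h2
    have hrfac : (0 : ℝ) < r.factorial := by positivity
    have hkr : (0 : ℝ) < (k : ℝ) ^ r := by positivity
    rw [hq, div_mul_eq_mul_div, le_div_iff₀ (by positivity)]
    have h3 := mul_le_mul_of_nonneg_left h1 hkr.le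
    refine le_of_mul_le_mul_left ?_ hrfac
    linarith
  have hqT : 6 / 5 * (s * Real.log k) ≤ q * T := by
    have hq0 : 0 ≤ q := by positivity
    have h1 := mul_le_mul_of_nonneg_left hTge hq0
    have h2 := mul_le_mul_of_nonneg_left hqge (show 0 ≤ 3 / 5 * (s * Real.log k) by positivity)
    linarith
  -- With Q = `s.choose l / (8 * R ^ 2)`, the entropy term and `ρ * T` are each at most Q, while θ
  -- log 2 ≥ (4Q - 1) log 2 leaves room for both.
  have hslog' : s * Real.log k + s + 2 ≤ s.choose l / (8 * R ^ 2) := by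
    have h1 := Nat.four_mul_pow_le_choose (m := s) (r := l) (by omega)
    have h2 : (s : ℝ) ^ 2 ≤ s ^ l := pow_le_pow_right₀ hsR hl
    rw [le_div_iff₀ (by positivity)]
    have h3 := mul_le_mul_of_nonneg_left hslog (show (0 : ℝ) ≤ 4 * s by positivity)
    have h4 : (s * Real.log k + s + 2) * (8 * R ^ 2) ≤ s * (Real.log k + 3) * (8 * R ^ 2) := by
      gcongr
      linarith
    refine h4.trans (le_of_mul_le_mul_left ?_ (show (0 : ℝ) < 5 * l.factorial by positivity))
    linarith
  have hρT : ρ * T ≤ s.choose l / (8 * R ^ 2) := by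
    have h1 := Nat.four_mul_pow_le_choose (m := n) (r := l) (by omega)
    have hpow : (n : ℝ) ^ l = n * n ^ (l - 1) := by
      rw [← pow_succ', Nat.sub_add_cancel (by omega)]
    rw [hpow] at h1
    have h2 := mul_le_mul_of_nonneg_left hn (show (0 : ℝ) ≤ n by positivity)
    have h3 : 32 * R ^ 3 * (n * L) ≤ n.choose l := by
      refine le_of_mul_le_mul_left ?_ (show (0 : ℝ) < 5 * l.factorial by positivity)
      linarith
    calc ρ * T ≤ ρ * (4 * n * L) := by gcongr
      _ = s.choose l * (32 * R ^ 3 * (n * L)) / (n.choose l * (8 * R ^ 2)) := by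
          rw [hρ]; field_simp; ring
      _ ≤ s.choose l * n.choose l / (n.choose l * (8 * R ^ 2)) := by gcongr
      _ = _ := by field_simp
  have hU : 2 * (n.choose s : ℝ) * (1 - q) ^ T < 1 := by
    have h1 : (1 - q) ^ T ≤ Real.exp (-(q * T)) := by
      rw [← neg_mul, mul_comm, Real.exp_nat_mul]
      exact pow_le_pow_left₀ (by linarith) (Real.one_sub_le_exp_neg q) T
    calc 2 * (n.choose s : ℝ) * (1 - q) ^ T
        ≤ Real.exp 1 * Real.exp (s * Real.log k + s) * Real.exp (-(q * T)) := by gcongr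
      _ = Real.exp (1 + (s * Real.log k + s) + -(q * T)) := by rw [← Real.exp_add, ← Real.exp_add]
      _ < 1 := by
        rw [Real.exp_lt_one_iff]
        have := mul_le_mul_of_nonneg_left hk (show (0 : ℝ) ≤ s by positivity)
        linarith
  have hW : 2 * (n.choose s : ℝ) * (1 + ρ) ^ T < 2 ^ θ := by
    have h1 : (1 + ρ) ^ T ≤ Real.exp (ρ * T) := by
      rw [mul_comm, Real.exp_nat_mul]
      refine pow_le_pow_left₀ (by positivity) ?_ T
      rw [add_comm]
      exact Real.add_one_le_exp ρ
    calc 2 * (n.choose s : ℝ) * (1 + ρ) ^ T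
        ≤ Real.exp 1 * Real.exp (s * Real.log k + s) * Real.exp (ρ * T) := by gcongr
      _ = Real.exp (1 + (s * Real.log k + s) + ρ * T) := by rw [← Real.exp_add, ← Real.exp_add]
      _ < Real.exp (θ * Real.log 2) := by
        rw [Real.exp_lt_exp]
        have hl2 := Real.log_two_gt_d9
        have hl2' := Real.log_two_lt_d9
        have h8 : (s.choose l : ℝ) / (2 * R ^ 2) = 4 * (s.choose l / (8 * R ^ 2)) := by
          field_simp; norm_num
        rw [h8] at hθge
        have h9 := mul_le_mul_of_nonneg_right hθge (show 0 ≤ Real.log 2 by linarith)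
        have h10 : 0 ≤ (s.choose l : ℝ) / (8 * R ^ 2) := by positivity
        have h11 := mul_le_mul_of_nonneg_left hl2.le h10
        linarith
      _ = 2 ^ θ := by rw [Real.exp_nat_mul, Real.exp_log two_pos]
  obtain ⟨F, hFT, hFr, hFl, hFS⟩ := Finset.exists_system_of_potential (r := r) (l := l) (s := s)
    (θ := θ) (T := T) (q := q) (ρ := ρ) (Finset.univ : Finset (Fin n))
    (by simpa using hrs.trans hsn) hq1 (by positivity)
    (by
      simp only [Finset.card_univ, Fintype.card_fin]
      have h1 : q * n.choose r = s.choose r / 2 := by rw [hq]; field_simp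
      rw [h1]
      have h2 := mul_le_mul_of_nonneg_right hθle
        (show (0 : ℝ) ≤ (s - l).choose (r - l) by positivity)
      rw [← hids] at h2
      have h3 : θ * (R * (s - l).choose (r - l)) ≤ (s.choose r : ℝ) / 2 := by
        refine le_of_mul_le_mul_right ?_ (show (0 : ℝ) < 2 * R by positivity)
        linarith
      linarith)
    (by
      simp only [Finset.card_univ, Fintype.card_fin]
      rw [hρ, div_mul_eq_mul_div, le_div_iff₀ hnl, mul_assoc _ R, mul_comm R, hidn]
      exact le_of_eq (by ring))
    (by simpa using hU) (by simpa using hW)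
  exact ⟨F, le_trans (by exact_mod_cast hFT) hTle, hFr, hFl,
    fun S hS => hFS S (Finset.subset_univ S) hS⟩

/-! ### From the hitting property to the chromatic number. -/

theorem exists_mem_systemSizes {r l k s : ℕ} (hk : 0 < k)
    {F : Finset (Finset (Fin (k * s)))} (hFr : ∀ f ∈ F, f.card = r)
    (hFl : ∀ f ∈ F, ∀ g ∈ F, f ≠ g → (f ∩ g).card < l)
    (hFS : ∀ S : Finset (Fin (k * s)), S.card = s → ∃ f ∈ F, f ⊆ S) :
    F.card ∈ systemSizes r l k := by
  refine ⟨Fin (k * s), ⟨Set.univ, (fun f : Finset (Fin (k * s)) => (f : Set (Fin (k * s)))) '' F,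
    fun _ _ => Set.subset_univ _⟩, Set.toFinite _, ⟨?_, ?_⟩, ?_, ?_⟩
  · rintro _ ⟨f, hf, rfl⟩
    simp [Set.encard_coe_eq_coe_finsetCard, hFr f hf]
  · rintro _ ⟨f, hf, rfl⟩ _ ⟨g, hg, rfl⟩ hfg
    simp only [← Finset.coe_inter, Set.encard_coe_eq_coe_finsetCard]
    exact_mod_cast hFl f hf g hg fun h => hfg (by rw [h])
  · refine lt_of_lt_of_le (b := ((k + 1 : ℕ) : ℕ∞)) (by exact_mod_cast Nat.lt_succ_self k) ?_
    refine le_iInf₂ fun m hm => ?_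
    by_contra! hlt
    have hmk : m ≤ k := Nat.lt_succ_iff.1 (by exact_mod_cast hlt)
    obtain ⟨c, hc, hce⟩ := hm
    obtain ⟨y, -, hy⟩ := Finset.exists_le_card_fiber_of_mul_le_card_of_maps_to
      (s := (Finset.univ : Finset (Fin (k * s)))) (t := Finset.range k) (f := c) (n := s)
      (fun a _ => Finset.mem_range.2 ((hc a (Set.mem_univ a)).trans_le hmk))
      ⟨0, Finset.mem_range.2 hk⟩ (by simp)
    obtain ⟨S, hSy, hSs⟩ := Finset.exists_subset_card_eq hy
    obtain ⟨f, hf, hfS⟩ := hFS S hSs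
    obtain ⟨u, hu, v, hv, huv⟩ := hce _ ⟨f, hf, rfl⟩
    exact huv ((Finset.mem_filter.1 (hSy (hfS hu))).2.trans
      (Finset.mem_filter.1 (hSy (hfS hv))).2.symm)
  · rw [Finset.coe_injective.encard_image, Set.encard_coe_eq_coe_finsetCard]

/-! ### Comparison with the stated constant. -/

theorem Nat.choose_le_three_mul_div_pow {r l : ℕ} (hl : 2 ≤ l) (hlr : l < r) :
    (r.choose l : ℝ) ≤ (3 * ((r : ℝ) - 1) / ((l : ℝ) - 1)) ^ l := by
  have hl2 : (2 : ℝ) ≤ l := by exact_mod_cast hl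
  have hlr' : (l : ℝ) ≤ r := by exact_mod_cast hlr.le
  have h1 := Nat.choose_le_pow_div (α := ℝ) l r
  have h2 := Real.pow_div_factorial_le_exp (l : ℝ) (by positivity) l
  have h3 : Real.exp l ≤ 3 ^ l := by
    rw [← mul_one (l : ℝ), Real.exp_nat_mul]
    exact pow_le_pow_left₀ (Real.exp_pos 1).le (by have := Real.exp_one_lt_d9; linarith) l
  have h4 : (r : ℝ) / l ≤ (r - 1) / (l - 1) := by
    rw [div_le_div_iff₀ (by linarith) (by linarith)]
    linarith
  calc (r.choose l : ℝ) ≤ r ^ l / l.factorial := h1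
    _ = (r / l : ℝ) ^ l * (l ^ l / l.factorial) := by rw [div_pow]; field_simp
    _ ≤ ((r - 1) / (l - 1) : ℝ) ^ l * 3 ^ l :=
        mul_le_mul (pow_le_pow_left₀ (by positivity) h4 l) (h2.trans h3) (by positivity)
          (pow_nonneg (div_nonneg (by linarith) (by linarith)) l)
    _ = _ := by rw [← mul_pow]; ring

/-- One of the three factors R = `r.choose l` is absorbed by R ≤ (3(r-1)/(l-1))^l. Replacing 3 by 10
gains at least 10/3, and 2 · 10/3 > 6. -/
theorem lt_systemConst {r l : ℕ} (hl : 2 ≤ l) (hlr : l < r) :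
    6 * (40 * (l.factorial : ℝ) * (r.choose l : ℝ) ^ 3) ^ (1 / ((l : ℝ) - 1)) <
      systemConst r l := by
  have hl2 : (2 : ℝ) ≤ l := by exact_mod_cast hl
  have hlr' : (l : ℝ) ≤ r := by exact_mod_cast hlr.le
  have hR : (0 : ℝ) < r.choose l := by exact_mod_cast Nat.choose_pos hlr.le
  have hp : 0 < 1 / ((l : ℝ) - 1) := one_div_pos.2 (by linarith)
  have hlp : (l : ℝ) / (l - 1) = l * (1 / (l - 1)) := by ring
  have hlp1 : 1 ≤ (l : ℝ) * (1 / (l - 1)) := by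
    rw [← hlp, one_le_div (by linarith)]; linarith
  have hdesc : 100 * (r.descFactorial l : ℝ) ^ 2 / l.factorial =
      100 * l.factorial * (r.choose l : ℝ) ^ 2 := by
    rw [Nat.descFactorial_eq_factorial_mul_choose]
    push_cast
    field_simp
  rw [systemConst, hdesc, hlp]
  set p := 1 / ((l : ℝ) - 1)
  have hbase : 10 * ((r : ℝ) - 1) / (l - 1) = 10 / 3 * (3 * (r - 1) / (l - 1)) := by ring
  have hnn : 0 ≤ 3 * ((r : ℝ) - 1) / (l - 1) := div_nonneg (by linarith) (by linarith)
  have h1 : 10 / 3 * (r.choose l : ℝ) ^ p ≤ (10 * ((r : ℝ) - 1) / (l - 1)) ^ (l * p) := by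
    rw [hbase, Real.mul_rpow (by norm_num) hnn]
    refine mul_le_mul (Real.self_le_rpow_of_one_le (by norm_num) hlp1) ?_ (by positivity)
      (by positivity)
    rw [Real.rpow_mul hnn, Real.rpow_natCast]
    exact Real.rpow_le_rpow hR.le (Nat.choose_le_three_mul_div_pow hl hlr) hp.le
  have h2 : (40 * (l.factorial : ℝ) * (r.choose l : ℝ) ^ 3) ^ p ≤
      (100 * l.factorial * (r.choose l : ℝ) ^ 2) ^ p * (r.choose l : ℝ) ^ p := by
    rw [← Real.mul_rpow (by positivity) hR.le]
    refine Real.rpow_le_rpow (by positivity) ?_ hp.le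
    have : (0 : ℝ) ≤ l.factorial * (r.choose l : ℝ) ^ 3 := by positivity
    linarith
  have h3 : (0 : ℝ) < (40 * (l.factorial : ℝ) * (r.choose l : ℝ) ^ 3) ^ p := by positivity
  have h4 : (0 : ℝ) ≤ (100 * l.factorial * (r.choose l : ℝ) ^ 2) ^ p := by positivity
  have h5 := mul_le_mul_of_nonneg_left h1 h4
  linarith

/-! ### Large k and conclusion. -/

theorem eventually_mul_log_add_le_rpow (C D : ℝ) {p : ℝ} (hp : 0 < p) :
    ∀ᶠ k : ℕ in atTop, C * Real.log k + D ≤ (k : ℝ) ^ p := by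
  have h1 : ∀ᶠ x : ℝ in atTop, C * Real.log x ≤ 1 / 2 * x ^ p := by
    have := ((isLittleO_log_rpow_atTop hp).const_mul_left C).bound (show (0 : ℝ) < 1 / 2 by norm_num)
    filter_upwards [this, eventually_ge_atTop 0] with x hx hx0
    rw [Real.norm_of_nonneg (Real.rpow_nonneg hx0 p)] at hx
    exact (le_abs_self _).trans hx
  have h2 := (tendsto_rpow_atTop hp).eventually_ge_atTop (2 * D)
  filter_upwards [tendsto_natCast_atTop_atTop.eventually (h1.and h2)] with k hk
  linarith [hk.1, hk.2]

theorem theorem3 (r l : ℕ) (hl : 2 ≤ l) (hlr : l < r) :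
    ∀ᶠ k : ℕ in atTop, ∃ m : ℕ, IsLeast (systemSizes r l k) m ∧
      (m : ℝ) < systemConst r l *
        ((k : ℝ) ^ (r - 1) * Real.log k) ^ ((l : ℝ) / ((l : ℝ) - 1)) := by
  have hl2 : (2 : ℝ) ≤ l := by exact_mod_cast hl
  have hR : (1 : ℝ) ≤ r.choose l := by exact_mod_cast Nat.choose_pos hlr.le
  have hlfac : (1 : ℝ) ≤ l.factorial := by exact_mod_cast Nat.factorial_pos l
  have hconst := lt_systemConst hl hlr
  have hp : 0 < 1 / ((l : ℝ) - 1) := one_div_pos.2 (by linarith)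
  have hlp : (l : ℝ) / (l - 1) = 1 / (l - 1) + 1 := by
    have : (l : ℝ) - 1 ≠ 0 := by linarith
    field_simp
    ring
  have hpl : 1 / ((l : ℝ) - 1) = ((l - 1 : ℕ) : ℝ)⁻¹ := by
    rw [Nat.cast_sub (by omega), Nat.cast_one, one_div]
  rw [hlp]
  set B : ℝ := 40 * (l.factorial : ℝ) * (r.choose l : ℝ) ^ 3 with hB
  have hB1 : 1 ≤ B := by
    have := one_le_mul_of_one_le_of_one_le hlfac (one_le_pow₀ hR (n := 3))
    rw [hB, mul_assoc]; linarith
  set p : ℝ := 1 / ((l : ℝ) - 1) with hpdef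
  set C : ℝ := 10 * (r.choose l : ℝ) ^ 2 * l.factorial with hC
  filter_upwards [eventually_mul_log_add_le_rpow C (C * 3) hp,
    eventually_mul_log_add_le_rpow 0 (5 * r ^ 2) hp, eventually_mul_log_add_le_rpow 0 2 hp,
    (Real.tendsto_log_atTop.comp tendsto_natCast_atTop_atTop).eventually_ge_atTop 11,
    eventually_gt_atTop 0] with k hk1 hk2 hk3 hk4 hk0
  replace hk4 : 11 ≤ Real.log k := hk4
  have hkR : (1 : ℝ) ≤ k := by exact_mod_cast hk0
  set L : ℝ := (k : ℝ) ^ (r - 1) * Real.log k with hL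
  have hLk : (k : ℝ) ^ l ≤ L := by
    have h1 : (k : ℝ) ^ l ≤ k ^ (r - 1) := pow_le_pow_right₀ hkR (by omega)
    have h2 : (0 : ℝ) ≤ k ^ (r - 1) := by positivity
    rw [hL]; nlinarith
  have hL0 : 0 < L := lt_of_lt_of_le (by positivity) hLk
  -- Chosen so that (kX)^(l-1) = BL, the least n allowed by the crowding condition. As l ≤ r - 1, X
  -- is at least k^p and so outgrows every multiple of log k.
  set X : ℝ := (B * L) ^ p / k with hX
  have hkX : k * X = (B * L) ^ p := by rw [hX]; field_simp
  have hXk : (k : ℝ) ^ p ≤ X := by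
    have h1 : ((k : ℝ) ^ l) ^ p ≤ (B * L) ^ p := by
      refine Real.rpow_le_rpow (by positivity) ?_ hp.le
      nlinarith
    rw [← Real.rpow_natCast, ← Real.rpow_mul (by positivity)] at h1
    rw [show (l : ℝ) * p = p + 1 by rw [← hlp, hpdef]; ring,
      Real.rpow_add (by positivity), Real.rpow_one] at h1
    rw [hX, le_div_iff₀ (by positivity)]
    exact h1
  set s : ℕ := ⌈X⌉₊ with hs
  have hXs : X ≤ s := Nat.le_ceil X
  -- Rounding up costs at most 3/2 because X ≥ 2; with the 4 of the edge bound this makes the 6 of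
  -- `lt_systemConst`.
  have hsX : (s : ℝ) ≤ 3 / 2 * X := by
    have := Nat.ceil_lt_add_one (a := X) (by linarith)
    rw [← hs] at this
    linarith
  obtain ⟨F, hFc, hFr, hFl, hFS⟩ := exists_system_meeting_all (k := k) (s := s) hl hlr hk4
    (by
      have : (5 * r ^ 2 : ℝ) ≤ s := by linarith
      exact_mod_cast this)
    (by rw [← hC]; linarith)
    (by
      rw [← hB, ← hL]
      have h1 : (B * L) ^ p ≤ ((k * s : ℕ) : ℝ) := by
        rw [← hkX]; push_cast; gcongr
      have h2 := pow_le_pow_left₀ (by positivity) h1 (l - 1)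
      rwa [hpl, Real.rpow_inv_natCast_pow (by positivity) (by omega)] at h2)
  have hmem := exists_mem_systemSizes hk0 hFr hFl hFS
  refine ⟨sInf (systemSizes r l k), ⟨Nat.sInf_mem ⟨_, hmem⟩, fun _ h => Nat.sInf_le h⟩, ?_⟩
  have hmF : ((sInf (systemSizes r l k) : ℕ) : ℝ) ≤ F.card := by exact_mod_cast Nat.sInf_le hmem
  calc ((sInf (systemSizes r l k) : ℕ) : ℝ) ≤ 4 * (k * s : ℕ) * L := hmF.trans hFc
    _ ≤ 4 * (k * (3 / 2 * X)) * L := by push_cast; gcongr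
    _ = 6 * (k * X) * L := by ring
    _ = 6 * B ^ p * L ^ (p + 1) := by
      rw [hkX, Real.mul_rpow (by positivity) hL0.le, Real.rpow_add hL0, Real.rpow_one]; ring
    _ < systemConst r l * L ^ (p + 1) := by gcongr
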